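/- All graphs are finite and simple, $d$ is the graph distance, and the end-vertices of $G$ are its vertices of degree one; $\tau(G)$ is the set of end-vertices. Let $G$ be a connected graph. A vertex $v$ strongly resolves two different vertices $x,y$ if $d(x,v)=d(x,y)+d(y,v)$ or $d(y,v)=d(y,x)+d(x,v)$; the strong metric dimension $dim_s(G)$ is the minimum cardinality of a set $S$ of vertices such that every two different vertices of $G$ are strongly resolved by some vertex of $S$. For a nonempty set $W$ of vertices put $d(x,W)=\min_{w\in W}d(x,w)$; $W$ strongly resolves two different vertices $x,y\notin W$ if $d(x,W)=d(x,y)+d(y,W)$ or $d(y,W)=d(y,x)+d(x,W)$. The strong partition dimension $pd_s(G)$ is the minimum number of parts of a partition $\Pi$ of the vertex set into nonempty parts such that every two different vertices in the same part are strongly resolved by some part of $\Pi$. For integers $r\ge 2$ and $t\ge 4$, let $\mathcal{C}_1(r,t)$ be the class of connected graphs $G$ with exactly one cycle $C_t$, where $C_t$ has $t$ vertices, exactly one vertex $v$ of $C_t$ has degree greater than two in $G$, and $ter(v)=\deg(v)-2=|\tau(G)|=r$. Here $ter(v)$ is the number of end-vertices $u$ of $G$ with $d(u,v)<d(u,w)$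 for every other vertex $w$ of $C_t$. (That is, $G$ is a cycle $C_t$ with $r$ pendant paths attached at one of its vertices.) **Proposition.** If $r\ge 2$, $t\ge 4$ and $G\in\mathcal{C}_1(r,t)$, then $$pd_s(G)=r+1\quad\text{and}\quad dim_s(G)=\begin{cases} r+\frac{t-1}{2}, & t \text{ odd},\\ r+\frac{t-2}{2}, & t\text{ even}.\end{cases}$$ Moreover, for every $r\ge 2$ and every integer $N\ge 0$ there are $t\ge 4$ and $G\in\mathcal{C}_1(r,t)$ with $dim_s(G)-pd_s(G)=N$; in particular the difference between the two parameters can be arbitrarily large. -/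

import Mathlib

open Finset

namespace StrongDim

variable {V : Type*}

/-- The vertex `v` strongly resolves the vertices `x` and `y` of `G`. -/
def VertexResolves (G : SimpleGraph V) (v x y : V) : Prop :=
  G.dist x v = G.dist x y + G.dist y v ∨ G.dist y v = G.dist y x + G.dist x v

/-- `S` is a strong resolving set for `G`: every two different vertices of `G` are strongly
resolved by some vertex of `S`. -/
def IsStrongResolvingSet (G : SimpleGraph V) (S : Finset V) : Prop :=
  ∀ x y : V, x ≠ y → ∃ v ∈ S, VertexResolves G v x y

/-- The strong metric dimension `dim_s(G)`: the minimum cardinality of a strong resolving set.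
On a finite vertex set the whole vertex set is one, so the minimum exists. -/
noncomputable def strongMetricDim [Fintype V] (G : SimpleGraph V) : ℕ :=
  sInf {k | ∃ S : Finset V, IsStrongResolvingSet G S ∧ S.card = k}

/-- The distance `d_G(x, W) = min {d_G(x, w) : w ∈ W}`, for a nonempty set `W`. -/
noncomputable def distToSet (G : SimpleGraph V) (x : V) (W : Finset V) : ℕ :=
  sInf {k | ∃ w ∈ W, G.dist x w = k}

/-- The set `W` strongly resolves the vertices `x, y ∉ W`. -/
def SetResolves (G : SimpleGraph V) (W : Finset V) (x y : V) : Prop :=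
  x ∉ W ∧ y ∉ W ∧
    (distToSet G x W = G.dist x y + distToSet G y W ∨
      distToSet G y W = G.dist y x + distToSet G x W)

/-- `P` is a strong resolving partition: every two different vertices that belong to the same
part are strongly resolved by some part. (The parts of a `Finpartition` are nonempty.) -/
def IsStrongResolvingPartition [Fintype V] [DecidableEq V] (G : SimpleGraph V)
    (P : Finpartition (univ : Finset V)) : Prop :=
  ∀ U ∈ P.parts, ∀ x ∈ U, ∀ y ∈ U, x ≠ y → ∃ W ∈ P.parts, SetResolves G W x y

/-- The strong partition dimension `pd_s(G)`: the minimum cardinality of a strong resolving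
partition. The partition into singletons is one, so the minimum exists. -/
noncomputable def strongPartitionDim [Fintype V] [DecidableEq V] (G : SimpleGraph V) : ℕ :=
  sInf {k | ∃ P : Finpartition (univ : Finset V),
    IsStrongResolvingPartition G P ∧ P.parts.card = k}

/-- The subgraph `C` of `G` is a cycle. -/
def IsCycleSubgraph (G : SimpleGraph V) (C : G.Subgraph) : Prop :=
  ∃ (u : V) (c : G.Walk u u), c.IsCycle ∧ c.toSubgraph = C

/-- `G` is a unicyclic graph (connected with exactly one cycle) whose unique cycle is `C`. -/
def IsUnicyclicWith (G : SimpleGraph V) (C : G.Subgraph) : Prop :=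
  G.Connected ∧ IsCycleSubgraph G C ∧ ∀ C' : G.Subgraph, IsCycleSubgraph G C' → C' = C

/-- The end-vertices of `G`: the vertices of degree one. -/
def endVertices [Fintype V] (G : SimpleGraph V) [DecidableRel G.Adj] : Finset V :=
  {u | G.degree u = 1}

/-- The end-vertex `u` is a terminal vertex of the vertex `v` of the cycle `C`: it is strictly
closer to `v` than to every other vertex of `C`. -/
def IsTerminalVertex [Fintype V] (G : SimpleGraph V) [DecidableRel G.Adj] (C : G.Subgraph)
    (v u : V) : Prop :=
  u ∈ endVertices G ∧ ∀ w ∈ C.verts, w ≠ v → G.dist u v < G.dist u w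

/-- The terminal degree `ter(v)` of a vertex `v` of the cycle `C`. -/
noncomputable def terminalDegree [Fintype V] (G : SimpleGraph V) [DecidableRel G.Adj]
    (C : G.Subgraph) (v : V) : ℕ :=
  {u | IsTerminalVertex G C v u}.ncard

/-- `G` is a graph `G(r,t)` of the family `𝒞₁`, where `r ≥ 2` and `t ≥ 4`: it is unicyclic, its
unique cycle `C` has `t` vertices, and `C` has exactly one vertex `v` of degree greater than two,
for which `ter(v) = deg(v) - 2 = |τ(G)| = r`, with `τ(G)` the set of end-vertices of `G`. -/
def IsFamilyC1 [Fintype V] (G : SimpleGraph V) [DecidableRel G.Adj] (r t : ℕ) : Prop :=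
  2 ≤ r ∧ 4 ≤ t ∧
  ∃ C : G.Subgraph, IsUnicyclicWith G C ∧ C.verts.ncard = t ∧
    ∃ v ∈ C.verts, 2 < G.degree v ∧ (∀ w ∈ C.verts, 2 < G.degree w → w = v) ∧
      terminalDegree G C v = r ∧ G.degree v - 2 = r ∧ (endVertices G).card = r

end StrongDim

namespace StrongDim

/-! ### Mutually maximally distant pairs and strong resolution -/

section

variable {V : Type*} {G : SimpleGraph V}

/-! Two mutually maximally distant vertices are strongly resolved only by themselves, since a
geodesic through one of them cannot be continued past the other. Conversely, every geodesic extends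
to one with mutually maximally distant ends. So strong resolving sets are exactly the vertex covers
of the graph of such pairs, and in a strong resolving partition no part contains such a pair.

In a cycle with r legs at `c 0` these pairs are known well enough: end-vertices pair with each other
and with the vertices `c (t / 2)` and `c ((t + 1) / 2)` opposite to `c 0`, and cycle vertices other
than `c 0` pair when they are antipodal. The end-vertices and `c 1, …, c ((t - 1) / 2)` form a
cover. No cover is smaller: it contains one end of each edge of an antipodal matching and, if it
omits an end-vertex, it contains all the others and the opposite vertices.

For partitions, the r end-vertices and `c (t / 2)` are pairwise mutually maximally distant, so r + 1
parts are needed. Colouring the legs separately, giving each half of the cycle the colour of a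
different leg and the opposite vertices a colour of their own shows that r + 1 suffice.

The passage from the definition of the class to coordinates is a degree count: the degrees of a
unicyclic graph have average two, so `v` and the end-vertices balance and every other degree is two.
-/

theorem exists_adj_dist_succ (hG : G.Connected) {x y : V} (h : x ≠ y) :
    ∃ z, G.Adj x z ∧ G.dist x y = G.dist z y + 1 := by
  obtain ⟨w, hw⟩ := hG.exists_walk_length_eq_dist x y
  cases w with
  | nil => exact absurd rfl h
  | @cons _ z _ hxz p =>
    refine ⟨z, hxz, le_antisymm ?_ ?_⟩
    · have := hG.dist_triangle (u := x) (v := z) (w := y)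
      have h1 : G.dist x z = 1 := SimpleGraph.dist_eq_one_iff_adj.2 hxz
      omega
    · have := SimpleGraph.dist_le p
      simp only [SimpleGraph.Walk.length_cons] at hw
      omega

/-- No neighbour of `x` is farther from `y` than `x` is. -/
def IsMaxDistant (G : SimpleGraph V) (x y : V) : Prop :=
  ∀ z, G.Adj x z → G.dist z y ≤ G.dist x y

/-- The different vertices `x` and `y` are mutually maximally distant. -/
def IsMutuallyMaxDistant (G : SimpleGraph V) (x y : V) : Prop :=
  x ≠ y ∧ IsMaxDistant G x y ∧ IsMaxDistant G y x

theorem IsMutuallyMaxDistant.symm {x y : V} (h : IsMutuallyMaxDistant G x y) :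
    IsMutuallyMaxDistant G y x := ⟨h.1.symm, h.2.2, h.2.1⟩

/-- If `v` differed from `y`, the next vertex after `y` on a geodesic to `v` would be a neighbour of
`y` farther from `x`. -/
theorem IsMaxDistant.eq_of_dist_eq (hG : G.Connected) {x y v : V} (h : IsMaxDistant G y x)
    (hv : G.dist x v = G.dist x y + G.dist y v) : v = y := by
  by_contra hne
  obtain ⟨z, hz, hd⟩ := exists_adj_dist_succ hG (Ne.symm hne)
  have h1 := h z hz
  have h2 := hG.dist_triangle (u := x) (v := z) (w := v)
  rw [G.dist_comm (u := z), G.dist_comm (u := y)] at h1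
  omega

theorem IsMutuallyMaxDistant.eq_or_eq_of_resolves (hG : G.Connected) {x y v : V}
    (h : IsMutuallyMaxDistant G x y) (hv : VertexResolves G v x y) : v = x ∨ v = y := by
  rcases hv with hv | hv
  · exact Or.inr (h.2.2.eq_of_dist_eq hG hv)
  · exact Or.inl (h.2.1.eq_of_dist_eq hG hv)

theorem IsStrongResolvingSet.mem_or_mem (hG : G.Connected) {S : Finset V}
    (hS : IsStrongResolvingSet G S) {x y : V} (h : IsMutuallyMaxDistant G x y) :
    x ∈ S ∨ y ∈ S := by
  obtain ⟨v, hvS, hv⟩ := hS x y h.1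
  rcases h.eq_or_eq_of_resolves hG hv with rfl | rfl
  · exact Or.inl hvS
  · exact Or.inr hvS

theorem exists_dist_eq_distToSet {W : Finset V} (hW : W.Nonempty) (x : V) :
    ∃ w ∈ W, G.dist x w = distToSet G x W :=
  Nat.sInf_mem (s := {k | ∃ w ∈ W, G.dist x w = k}) <| by
    obtain ⟨w, hw⟩ := hW
    exact ⟨_, w, hw, rfl⟩

theorem distToSet_le {W : Finset V} {w : V} (hw : w ∈ W) (x : V) :
    distToSet G x W ≤ G.dist x w :=
  Nat.sInf_le ⟨w, hw, rfl⟩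

theorem distToSet_eq {W : Finset V} {w x : V} (hw : w ∈ W)
    (h : ∀ w' ∈ W, G.dist x w ≤ G.dist x w') : distToSet G x W = G.dist x w := by
  refine le_antisymm (distToSet_le hw x) ?_
  obtain ⟨w', hw', he⟩ := exists_dist_eq_distToSet (G := G) ⟨w, hw⟩ x
  exact he ▸ h w' hw'

theorem SetResolves.symm {W : Finset V} {x y : V} (h : SetResolves G W x y) :
    SetResolves G W y x := ⟨h.2.1, h.1, h.2.2.symm⟩

/-- A vertex of `W` nearest to `y` would lie beyond `y` on a geodesic from `x`, hence would be `y`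
itself. -/
theorem IsMaxDistant.distToSet_ne (hG : G.Connected) {W : Finset V} (hW : W.Nonempty) {x y : V}
    (hy : y ∉ W) (h : IsMaxDistant G y x) : distToSet G x W ≠ G.dist x y + distToSet G y W := by
  intro he
  obtain ⟨w, hw, hd⟩ := exists_dist_eq_distToSet (G := G) hW y
  refine hy (h.eq_of_dist_eq hG (v := w) ?_ ▸ hw)
  have := distToSet_le (G := G) hw x
  have := hG.dist_triangle (u := x) (v := y) (w := w)
  omega

theorem IsMutuallyMaxDistant.not_setResolves (hG : G.Connected) {W : Finset V} (hW : W.Nonempty)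
    {x y : V} (h : IsMutuallyMaxDistant G x y) : ¬ SetResolves G W x y := fun hr =>
  hr.2.2.elim (h.2.2.distToSet_ne hG hW hr.2.1) (h.2.1.distToSet_ne hG hW hr.1)

/-- A geodesic from `x` to `y` is extended at both ends to a longest one. Its ends are mutually
maximally distant, so one of them is in `S`, and either end resolves `x, y`. -/
theorem isStrongResolvingSet_of_forall_mem [Fintype V] (hG : G.Connected) {S : Finset V}
    (hS : ∀ x y, IsMutuallyMaxDistant G x y → x ∈ S ∨ y ∈ S) : IsStrongResolvingSet G S := by
  classical
  intro x y hxy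
  let Q : Finset (V × V) := {q | G.dist q.1 q.2 = G.dist q.1 x + G.dist x y + G.dist y q.2}
  have hQ : Q.Nonempty := ⟨(x, y), by simp [Q]⟩
  obtain ⟨⟨u, w⟩, huw, hmax⟩ := Q.exists_max_image (fun q => G.dist q.1 q.2) hQ
  simp only [Q, mem_filter, mem_univ, true_and, Prod.forall] at huw hmax
  have hpos := hG.pos_dist_of_ne hxy
  have t1 := fun a b c : V => hG.dist_triangle (u := a) (v := b) (w := c)
  have step : ∀ a b : V, G.Adj a b → G.dist a b = 1 :=
    fun a b h => SimpleGraph.dist_eq_one_iff_adj.2 h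
  have hmmd : IsMutuallyMaxDistant G u w := by
    refine ⟨fun h => ?_, fun z hz => ?_, fun z hz => ?_⟩
    · subst h; simp at huw; omega
    · by_contra! hlt
      have h1 := t1 z u w
      have h2 := t1 z u x
      have h3 := t1 z x w
      have h4 := t1 x y w
      have h5 := step _ _ hz.symm
      have := hmax z w (by omega)
      omega
    · rw [G.dist_comm (u := z), G.dist_comm (u := w)]
      by_contra! hlt
      have h1 := t1 u w z
      have h2 := t1 y w z
      have h3 := t1 u y z
      have h4 := t1 u x y
      have h5 := step _ _ hz
      have := hmax u z (by omega)
      omega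
  rcases hS u w hmmd with hu | hw
  · refine ⟨u, hu, Or.inr ?_⟩
    have h1 := t1 u x y
    have h2 := t1 u y w
    rw [G.dist_comm (u := y) (v := u), G.dist_comm (u := y) (v := x), G.dist_comm (u := x) (v := u)]
    omega
  · refine ⟨w, hw, Or.inl ?_⟩
    have h1 := t1 x y w
    have h2 := t1 u x w
    omega

end

/-! ### Coordinates and distances on a cycle with legs -/

section

variable {V : Type*}

/-- Every walk leaving `A` passes through `v`. -/
theorem dist_eq_of_separates {G : SimpleGraph V} (hG : G.Connected) {A : Set V} {v : V}
    (hA : ∀ x ∈ A, ∀ z, G.Adj x z → z ∈ A ∨ z = v) {x y : V} (hx : x ∈ A) (hy : y ∉ A) :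
    G.dist x y = G.dist x v + G.dist v y := by
  refine le_antisymm hG.dist_triangle ?_
  obtain ⟨w, hw⟩ := hG.exists_walk_length_eq_dist x y
  rw [← hw]
  clear hw
  induction w with
  | nil => exact absurd hx hy
  | @cons a b c hab p ih =>
    have h1 : G.dist a b = 1 := SimpleGraph.dist_eq_one_iff_adj.2 hab
    rw [SimpleGraph.Walk.length_cons]
    rcases hA a hx b hab with hb | rfl
    · have := ih hb hy
      have := hG.dist_triangle (u := a) (v := b) (w := v)
      omega
    · have := SimpleGraph.dist_le p
      omega

/-- The distance of the positions `i, j ≤ t` on a cycle of length `t`. -/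
def cycDist (t i j : ℕ) : ℕ := min ((i - j) + (j - i)) (t - ((i - j) + (j - i)))

/-- Coordinates on a graph that consists of a cycle `c 0, …, c (t - 1)` and, for every end-vertex
`u`, a path `leg u` of length `len u` from `c 0` to `u`. -/
structure CycleWithLegs [Fintype V] (G : SimpleGraph V) [DecidableRel G.Adj] (t : ℕ) where
  c : ℕ → V
  leg : V → ℕ → V
  len : V → ℕ
  conn : G.Connected
  four_le : 4 ≤ t
  -- Positions run up to `t` so that the cycle closes without modular arithmetic; `c` is
  -- unconstrained beyond `t`, as is `leg u` when `u` is not an end-vertex.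
  c_last : c t = c 0
  c_inj : ∀ {i j}, i < t → j < t → c i = c j → i = j
  c_adj : ∀ {i}, i < t → G.Adj (c i) (c (i + 1))
  c_nbr : ∀ {i z}, 0 < i → i < t → G.Adj (c i) z → z = c (i - 1) ∨ z = c (i + 1)
  len_pos : ∀ {u}, u ∈ endVertices G → 0 < len u
  leg_zero : ∀ {u}, u ∈ endVertices G → leg u 0 = c 0
  leg_len : ∀ {u}, u ∈ endVertices G → leg u (len u) = u
  leg_adj : ∀ {u a}, u ∈ endVertices G → a < len u → G.Adj (leg u a) (leg u (a + 1))
  leg_nbr : ∀ {u a z}, u ∈ endVertices G → 0 < a → a ≤ len u → G.Adj (leg u a) z →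
    z = leg u (a - 1) ∨ (a < len u ∧ z = leg u (a + 1))
  leg_dist : ∀ {u a b}, u ∈ endVertices G → a ≤ b → b ≤ len u →
    G.dist (leg u a) (leg u b) = b - a
  leg_inj : ∀ {u u' a b}, u ∈ endVertices G → u' ∈ endVertices G → 0 < a → a ≤ len u → 0 < b →
    b ≤ len u' → leg u a = leg u' b → u = u'
  leg_ne_c : ∀ {u a i}, u ∈ endVertices G → 0 < a → a ≤ len u → i < t → leg u a ≠ c i
  cover : ∀ x, (∃ i < t, x = c i) ∨
    ∃ u ∈ endVertices G, ∃ a, 0 < a ∧ a ≤ len u ∧ x = leg u a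

namespace CycleWithLegs

variable [Fintype V] {G : SimpleGraph V} [DecidableRel G.Adj] {t : ℕ} (X : CycleWithLegs G t)
include X

theorem dist_c_le_sub {i j : ℕ} (hij : i ≤ j) (hj : j ≤ t) :
    G.dist (X.c i) (X.c j) ≤ j - i := by
  induction j, hij using Nat.le_induction with
  | base => simp
  | succ j hij ih =>
    have h1 : G.dist (X.c j) (X.c (j + 1)) = 1 :=
      SimpleGraph.dist_eq_one_iff_adj.2 (X.c_adj (by omega))
    have := X.conn.dist_triangle (u := X.c i) (v := X.c j) (w := X.c (j + 1))
    have := ih (by omega)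
    omega

theorem dist_c_le {i j : ℕ} (hij : i ≤ j) (hj : j ≤ t) :
    G.dist (X.c i) (X.c j) ≤ cycDist t i j := by
  have h1 := X.dist_c_le_sub hij hj
  have h2 := X.dist_c_le_sub (Nat.zero_le i) (hij.trans hj)
  have h3 := X.dist_c_le_sub hj le_rfl
  rw [X.c_last, G.dist_comm] at h3
  rw [G.dist_comm] at h2
  have := X.conn.dist_triangle (u := X.c i) (v := X.c 0) (w := X.c j)
  unfold cycDist
  omega

/-- The lower bound for cycle distances. The second clause makes the induction cover walks that
leave the cycle: they can only return through `c 0`. -/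
theorem cycDist_le_length {j : ℕ} (hj : j ≤ t) {x y : V} (w : G.Walk x y) (hy : y = X.c j) :
    (∀ i < t, x = X.c i → cycDist t i j ≤ w.length) ∧
      ((∀ i < t, x ≠ X.c i) → cycDist t 0 j ≤ w.length) := by
  have ht := X.four_le
  induction w with
  | nil =>
    subst hy
    have hj' : ∀ i < t, X.c j = X.c i → j = i ∨ j = t ∧ i = 0 := fun i hi h => by
      rcases hj.lt_or_eq with hlt | rfl
      · exact Or.inl (X.c_inj hlt hi h)
      · exact Or.inr ⟨rfl, (X.c_inj (by omega) hi (X.c_last ▸ h)).symm⟩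
    refine ⟨fun i hi h => ?_, fun h => ?_⟩
    · have := hj' i hi h
      unfold cycDist
      omega
    · rcases hj.lt_or_eq with hlt | rfl
      · exact absurd rfl (h j hlt)
      · exact absurd X.c_last (h 0 (by omega))
  | @cons a b _ hab p ih =>
    obtain ⟨ih1, ih2⟩ := ih hy
    have hb : (∃ i < t, b = X.c i) ∨ ∀ i < t, b ≠ X.c i := by
      by_contra! h
      obtain ⟨i, hi, h'⟩ := h.2
      exact h.1 i hi h'
    rw [SimpleGraph.Walk.length_cons]
    refine ⟨fun i hi h => ?_, fun h => ?_⟩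
    · subst h
      rcases Nat.eq_zero_or_pos i with rfl | hi0
      · rcases hb with ⟨k, hk, rfl⟩ | hb
        · have := ih1 k hk rfl
          have hk0 : k ≠ 0 := by rintro rfl; exact G.irrefl hab
          have := X.c_nbr (by omega) hk hab.symm
          have h0 : 0 < t := by omega
          rcases this with h | h
          · have := X.c_inj h0 (by omega) h
            unfold cycDist at *
            omega
          · rcases (show k + 1 ≤ t from hk).lt_or_eq with hlt | heq
            · have := X.c_inj h0 hlt h
              omega
            · unfold cycDist at *
              omega
        · have := ih2 hb
          omega
      · rcases X.c_nbr hi0 hi hab with rfl | rfl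
        · have := ih1 (i - 1) (by omega) rfl
          unfold cycDist at *
          omega
        · rcases (show i + 1 ≤ t from hi).lt_or_eq with hlt | heq
          · have := ih1 (i + 1) hlt rfl
            unfold cycDist at *
            omega
          · have := ih1 0 (by omega) (by rw [heq, X.c_last])
            unfold cycDist at *
            omega
    · rcases hb with ⟨k, hk, rfl⟩ | hb
      · have : k = 0 := by
          by_contra hk0
          rcases X.c_nbr (by omega) hk hab.symm with h' | h'
          · exact h _ (by omega) h'
          · rcases (show k + 1 ≤ t from hk).lt_or_eq with hlt | heq
            · exact h _ hlt h'
            · exact h 0 (by omega) (by rw [h', heq, X.c_last])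
        subst this
        have := ih1 0 hk rfl
        omega
      · have := ih2 hb
        omega

theorem dist_c {i j : ℕ} (hi : i < t) (hj : j ≤ t) :
    G.dist (X.c i) (X.c j) = cycDist t i j := by
  refine le_antisymm ?_ ?_
  · rcases le_total i j with h | h
    · exact X.dist_c_le h hj
    · rw [G.dist_comm]
      refine (X.dist_c_le h hi.le).trans ?_
      unfold cycDist
      omega
  · obtain ⟨w, hw⟩ := X.conn.exists_walk_length_eq_dist (X.c i) (X.c j)
    exact hw ▸ (X.cycDist_le_length hj w rfl).1 i hi rfl

theorem dist_leg_eq {u : V} (hu : u ∈ endVertices G) {a : ℕ} (ha : 0 < a) (hal : a ≤ X.len u)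
    {y : V} (hy : ∀ b, 0 < b → b ≤ X.len u → y ≠ X.leg u b) :
    G.dist (X.leg u a) y = a + G.dist (X.c 0) y := by
  have := dist_eq_of_separates X.conn (A := {x | ∃ b, 0 < b ∧ b ≤ X.len u ∧ x = X.leg u b})
    (v := X.c 0) (x := X.leg u a) (y := y) ?_ ⟨a, ha, hal, rfl⟩ ?_
  · rw [this, ← X.leg_zero hu, G.dist_comm, X.leg_dist hu (Nat.zero_le _) hal, X.leg_zero hu]
    omega
  · rintro x ⟨b, hb, hbl, rfl⟩ z hz
    rcases X.leg_nbr hu hb hbl hz with rfl | ⟨hlt, rfl⟩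
    · rcases Nat.lt_or_ge 1 b with h | h
      · exact Or.inl ⟨b - 1, by omega, by omega, rfl⟩
      · exact Or.inr (by rw [show b - 1 = 0 by omega, X.leg_zero hu])
    · exact Or.inl ⟨b + 1, by omega, by omega, rfl⟩
  · rintro ⟨b, hb, hbl, h⟩
    exact hy b hb hbl h

theorem dist_leg_c {u : V} (hu : u ∈ endVertices G) {a i : ℕ} (ha : 0 < a) (hal : a ≤ X.len u)
    (hi : i < t) : G.dist (X.leg u a) (X.c i) = a + cycDist t 0 i := by
  rw [X.dist_leg_eq hu ha hal fun b hb hbl h => X.leg_ne_c hu hb hbl hi h.symm,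
    X.dist_c (by omega) hi.le]

end CycleWithLegs

end

/-! ### The strong metric dimension -/

section

variable {V : Type*}

namespace CycleWithLegs

variable [Fintype V] {G : SimpleGraph V} [DecidableRel G.Adj] {t : ℕ} (X : CycleWithLegs G t)
include X

theorem dist_leaf_c {u : V} (hu : u ∈ endVertices G) {i : ℕ} (hi : i < t) :
    G.dist u (X.c i) = X.len u + cycDist t 0 i := by
  have := X.dist_leg_c hu (X.len_pos hu) le_rfl hi
  rwa [X.leg_len hu] at this

theorem leaf_ne_c {u : V} (hu : u ∈ endVertices G) {i : ℕ} (hi : i < t) : u ≠ X.c i := by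
  have := X.leg_ne_c hu (X.len_pos hu) le_rfl hi
  rwa [X.leg_len hu] at this

/-- The only neighbour of an end-vertex is the first step of every geodesic leaving it. -/
theorem isMaxDistant_leaf {u y : V} (hu : u ∈ endVertices G) (hne : u ≠ y) :
    IsMaxDistant G u y := by
  have huniq : ∀ z, G.Adj u z → z = X.leg u (X.len u - 1) := fun z hz =>
    (X.leg_nbr hu (X.len_pos hu) le_rfl (by rwa [X.leg_len hu])).resolve_right (by omega)
  intro z hz
  obtain ⟨z', hz', hd⟩ := exists_adj_dist_succ X.conn hne
  rw [huniq z hz, ← huniq z' hz']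
  omega

theorem isMutuallyMaxDistant_leaf_leaf {u u' : V} (hu : u ∈ endVertices G)
    (hu' : u' ∈ endVertices G) (hne : u ≠ u') : IsMutuallyMaxDistant G u u' :=
  ⟨hne, X.isMaxDistant_leaf hu hne, X.isMaxDistant_leaf hu' hne.symm⟩

theorem isMutuallyMaxDistant_leaf_c {u : V} (hu : u ∈ endVertices G) {i : ℕ}
    (hi : i = t / 2 ∨ i = (t + 1) / 2) : IsMutuallyMaxDistant G u (X.c i) := by
  have ht := X.four_le
  have hit : i < t := by omega
  refine ⟨X.leaf_ne_c hu hit, X.isMaxDistant_leaf hu (X.leaf_ne_c hu hit), fun z hz => ?_⟩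
  rw [G.dist_comm, G.dist_comm (u := X.c i), X.dist_leaf_c hu hit]
  rcases X.c_nbr (by omega) hit hz with rfl | rfl
  all_goals
    rw [X.dist_leaf_c hu (by omega)]
    unfold cycDist
    omega

theorem isMaxDistant_c {i j : ℕ} (hi0 : 0 < i) (hi : i < t) (hj : j < t)
    (h : cycDist t i j = t / 2) : IsMaxDistant G (X.c i) (X.c j) := by
  intro z hz
  rw [X.dist_c hi hj.le, h, G.dist_comm]
  rcases X.c_nbr hi0 hi hz with rfl | rfl
  all_goals
    rw [X.dist_c hj (by omega)]
    unfold cycDist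
    omega

theorem isMutuallyMaxDistant_c_c {i h : ℕ} (hi0 : 0 < i) (hi : i + h < t)
    (hh : h = t / 2 ∨ h = (t + 1) / 2) : IsMutuallyMaxDistant G (X.c i) (X.c (i + h)) := by
  have ht := X.four_le
  refine ⟨fun he => ?_, X.isMaxDistant_c hi0 (by omega) hi ?_,
    X.isMaxDistant_c (by omega) hi (by omega) ?_⟩
  · have := X.c_inj (by omega) hi he
    omega
  all_goals
    unfold cycDist
    omega

/-- From `c 0` one moves away from a cycle vertex by entering a leg, and away from a leg vertex by
moving to `c 1`. -/
theorem not_isMaxDistant_c_zero (hne : (endVertices G).Nonempty) (y : V) :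
    ¬ IsMaxDistant G (X.c 0) y := by
  have ht := X.four_le
  intro h
  rcases X.cover y with ⟨i, hi, rfl⟩ | ⟨u, hu, b, hb, hbl, rfl⟩
  · obtain ⟨u, hu⟩ := hne
    have hadj := X.leg_adj hu (X.len_pos hu)
    rw [X.leg_zero hu] at hadj
    have := h _ hadj
    rw [X.dist_leg_c hu (by omega) (X.len_pos hu) hi, X.dist_c (by omega) hi.le] at this
    omega
  · have := h _ (X.c_adj (by omega))
    rw [G.dist_comm, G.dist_comm (u := X.c 0), X.dist_leg_c hu hb hbl (by omega),
      X.dist_leg_c hu hb hbl (by omega)] at this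
    unfold cycDist at this
    omega

theorem not_isMaxDistant_leg {u : V} (hu : u ∈ endVertices G) {a : ℕ} (ha : 0 < a)
    (hal : a < X.len u) {y : V} (hy : X.leg u a ≠ y) : ¬ IsMaxDistant G (X.leg u a) y := by
  intro h
  have hsucc := h _ (X.leg_adj hu hal)
  by_cases hmem : ∃ b, 0 < b ∧ b ≤ X.len u ∧ y = X.leg u b
  · obtain ⟨b, hb, hbl, rfl⟩ := hmem
    have hpred := h (X.leg u (a - 1)) (by
      have := X.leg_adj hu (show a - 1 < X.len u by omega)
      rw [Nat.sub_add_cancel ha] at this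
      exact this.symm)
    rcases lt_trichotomy a b with hab | rfl | hab
    · rw [X.leg_dist hu (by omega) hbl, X.leg_dist hu hab.le hbl] at hpred
      omega
    · exact hy rfl
    · rw [G.dist_comm, G.dist_comm (u := X.leg u a), X.leg_dist hu (by omega) hal,
        X.leg_dist hu hab.le hal.le] at hsucc
      omega
  · have hy' : ∀ b, 0 < b → b ≤ X.len u → y ≠ X.leg u b := fun b hb hbl he =>
      hmem ⟨b, hb, hbl, he⟩
    rw [X.dist_leg_eq hu (by omega) hal hy', X.dist_leg_eq hu ha hal.le hy'] at hsucc
    omega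

/-- Both vertices lie in the second half of the cycle, so `j - i + 1` is at most `t / 2` and
stepping back from `c i` increases the distance. -/
theorem not_isMaxDistant_c {i j : ℕ} (hi : (t - 1) / 2 < i) (hij : i < j) (hj : j < t) :
    ¬ IsMaxDistant G (X.c i) (X.c j) := by
  intro h
  have := h (X.c (i - 1)) (by
    have := X.c_adj (show i - 1 < t by omega)
    rw [Nat.sub_add_cancel (by omega)] at this
    exact this.symm)
  rw [X.dist_c (by omega) hj.le, X.dist_c (by omega) hj.le] at this
  unfold cycDist at this
  omega

theorem exists_strongResolvingSet (hne : (endVertices G).Nonempty) :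
    ∃ S : Finset V, IsStrongResolvingSet G S ∧ S.card ≤ (endVertices G).card + (t - 1) / 2 := by
  classical
  refine ⟨endVertices G ∪ (Icc 1 ((t - 1) / 2)).image X.c,
    isStrongResolvingSet_of_forall_mem X.conn fun x y hxy => ?_, ?_⟩
  · have key : ∀ x y, x ≠ y → IsMaxDistant G x y →
        x ∈ endVertices G ∪ (Icc 1 ((t - 1) / 2)).image X.c ∨
          ∃ i, (t - 1) / 2 < i ∧ i < t ∧ x = X.c i := by
      intro x y hne' h
      rcases X.cover x with ⟨i, hi, rfl⟩ | ⟨u, hu, a, ha, hal, rfl⟩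
      · have hi0 : i ≠ 0 := by
          rintro rfl
          exact X.not_isMaxDistant_c_zero hne y h
        by_cases him : i ≤ (t - 1) / 2
        · exact Or.inl (mem_union_right _ (mem_image_of_mem _ (mem_Icc.2 (by omega))))
        · exact Or.inr ⟨i, by omega, hi, rfl⟩
      · rcases hal.lt_or_eq with hlt | rfl
        · exact absurd h (X.not_isMaxDistant_leg hu ha hlt hne')
        · exact Or.inl (mem_union_left _ (by rwa [X.leg_len hu]))
    rcases key x y hxy.1 hxy.2.1 with h | ⟨i, hi, hit, rfl⟩
    · exact Or.inl h
    rcases key y _ hxy.1.symm hxy.2.2 with h | ⟨j, hj, hjt, rfl⟩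
    · exact Or.inr h
    exfalso
    rcases lt_trichotomy i j with hij | rfl | hij
    · exact X.not_isMaxDistant_c hi hij hjt hxy.2.1
    · exact hxy.1 rfl
    · exact X.not_isMaxDistant_c hj hij hit hxy.2.2
  · refine (card_union_le _ _).trans (Nat.add_le_add_left (card_image_le.trans ?_) _)
    simp

/-- Leaves and cycle vertices of `S` are counted separately. An omitted end-vertex costs one leaf
but forces the opposite vertices into `S`, which compensates for it. -/
theorem card_le_of_strongResolvingSet {S : Finset V} (hS : IsStrongResolvingSet G S) :
    (endVertices G).card + (t - 1) / 2 ≤ S.card := by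
  classical
  have ht := X.four_le
  set I : Finset ℕ := {i ∈ Ioo 0 t | X.c i ∈ S} with hI
  have hsplit : ((endVertices G).filter (· ∈ S)).card + I.card ≤ S.card := by
    have hinj : (I.image X.c).card = I.card := by
      refine card_image_of_injOn fun i hi j hj h => ?_
      simp only [hI, coe_filter, mem_Ioo, Set.mem_ofPred_eq] at hi hj
      exact X.c_inj hi.1.2 hj.1.2 h
    rw [← hinj, ← card_union_of_disjoint]
    · refine card_le_card fun x hx => ?_
      simp only [hI, mem_union, mem_filter, mem_image] at hx
      aesop
    · refine disjoint_left.2 fun x hx hx' => ?_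
      simp only [hI, mem_filter, mem_image, mem_Ioo] at hx hx'
      obtain ⟨i, hi, rfl⟩ := hx'
      exact X.leaf_ne_c hx.1 hi.1.2 rfl
  -- The pairs `c i, c (i + h)` with `1 ≤ i ≤ n` form a matching because `n ≤ h`; `M` selects an
  -- index in `S` from each.
  have hmatch : ∀ n h, (h = t / 2 ∨ h = (t + 1) / 2) → n ≤ h → n + h < t →
      ∃ M ⊆ I, M.card = n ∧ ∀ k ∈ M, k ≤ n ∨ h < k := by
    intro n h hh hnh hnt
    refine ⟨(Icc 1 n).image fun i => if X.c i ∈ S then i else i + h, ?_, ?_, ?_⟩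
    · intro k hk
      simp only [mem_image, mem_Icc] at hk
      obtain ⟨i, hi, rfl⟩ := hk
      simp only [hI, mem_filter, mem_Ioo]
      split_ifs with hiS
      · exact ⟨by omega, hiS⟩
      · exact ⟨by omega, (hS.mem_or_mem X.conn
          (X.isMutuallyMaxDistant_c_c (by omega) (by omega) hh)).resolve_left hiS⟩
    · rw [card_image_of_injOn]
      · simp
      · intro i hi j hj hij
        simp only [coe_Icc, Set.mem_Icc] at hi hj
        dsimp only at hij
        split_ifs at hij <;> omega
    · intro k hk
      simp only [mem_image, mem_Icc] at hk
      obtain ⟨i, hi, rfl⟩ := hk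
      split_ifs <;> omega
  by_cases hall : ∀ u ∈ endVertices G, u ∈ S
  · obtain ⟨M, hM, hMc, -⟩ := hmatch ((t - 1) / 2) (t / 2) (Or.inl rfl) (by omega) (by omega)
    rw [filter_true_of_mem hall] at hsplit
    have := card_le_card hM
    omega
  · push Not at hall
    obtain ⟨u, hu, huS⟩ := hall
    have hleaves : (endVertices G).card - 1 ≤ ((endVertices G).filter (· ∈ S)).card := by
      rw [← card_erase_of_mem hu]
      refine card_le_card fun u' hu' => ?_
      have hu'' := mem_of_mem_erase hu'
      exact mem_filter.2 ⟨hu'', (hS.mem_or_mem X.conn (X.isMutuallyMaxDistant_leaf_leaf hu hu''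
        (ne_of_mem_erase hu').symm)).resolve_left huS⟩
    have hmid : ∀ i, (i = t / 2 ∨ i = (t + 1) / 2) → i ∈ I := fun i hi =>
      mem_filter.2 ⟨mem_Ioo.2 (by omega), (hS.mem_or_mem X.conn
        (X.isMutuallyMaxDistant_leaf_c hu hi)).resolve_left huS⟩
    -- With this shift the matching avoids the opposite positions, which are one or two according to
    -- the parity of `t`.
    obtain ⟨M, hM, hMc, hMr⟩ := hmatch (t / 2 - 1) ((t + 1) / 2) (Or.inr rfl) (by omega) (by omega)
    have hdisj : Disjoint M (Icc (t / 2) ((t + 1) / 2)) := disjoint_left.2 fun k hk hk' => by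
      have := hMr k hk
      have := mem_Icc.1 hk'
      omega
    have hsub : M ∪ Icc (t / 2) ((t + 1) / 2) ⊆ I := union_subset hM fun k hk =>
      hmid k (by have := mem_Icc.1 hk; omega)
    have hcard := card_le_card hsub
    rw [card_union_of_disjoint hdisj, Nat.card_Icc] at hcard
    have := card_pos.2 ⟨u, hu⟩
    omega

theorem strongMetricDim_eq (hne : (endVertices G).Nonempty) :
    strongMetricDim G = (endVertices G).card + (t - 1) / 2 := by
  obtain ⟨S, hS, hc⟩ := X.exists_strongResolvingSet hne
  have hle : strongMetricDim G ≤ S.card := Nat.sInf_le ⟨S, hS, rfl⟩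
  refine le_antisymm (hle.trans hc) (le_csInf ⟨_, S, hS, rfl⟩ ?_)
  rintro k ⟨S', hS', rfl⟩
  exact X.card_le_of_strongResolvingSet hS'

end CycleWithLegs

end

/-! ### The strong partition dimension -/

section

variable {V : Type*}

theorem IsStrongResolvingPartition.card_le [Fintype V] [DecidableEq V] {G : SimpleGraph V}
    (hG : G.Connected) {P : Finpartition (univ : Finset V)} (hP : IsStrongResolvingPartition G P)
    {A : Finset V} (hA : ∀ x ∈ A, ∀ y ∈ A, x ≠ y → IsMutuallyMaxDistant G x y) :
    A.card ≤ P.parts.card := by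
  refine card_le_card_of_injOn P.part (fun x _ => P.part_mem.2 (mem_univ x)) ?_
  intro x hx y hy hxy
  by_contra hne
  obtain ⟨W, hW, hr⟩ := hP _ (P.part_mem.2 (mem_univ x)) x (P.mem_part (mem_univ x)) y
    (hxy ▸ P.mem_part (mem_univ y)) hne
  exact (hA x hx y hy hne).not_setResolves hG (P.nonempty_of_mem_parts hW) hr

/-- The partition is into the fibres of `f`; there are at most as many as available colours. -/
theorem exists_strongResolvingPartition [Fintype V] [DecidableEq V] {G : SimpleGraph V}
    {f : V → V} {F : Finset V} (hF : ∀ x, f x ∈ F)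
    (hf : ∀ x y, x ≠ y → f x = f y → ∃ z, SetResolves G {w | f w = f z} x y) :
    ∃ P : Finpartition (univ : Finset V), IsStrongResolvingPartition G P ∧
      P.parts.card ≤ F.card := by
  classical
  have hparts : (Finpartition.ofSetoid (Setoid.ker f)).parts =
      univ.image fun a => ({w | f w = f a} : Finset V) := by
    simp only [Finpartition.ofSetoid, Finpartition.ofSetSetoid]
    refine image_congr fun a _ => ?_
    ext b
    simp [Setoid.ker_def, eq_comm]
  refine ⟨Finpartition.ofSetoid (Setoid.ker f), ?_, ?_⟩
  · intro U hU x hx y hy hne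
    rw [hparts] at hU ⊢
    obtain ⟨a, -, rfl⟩ := mem_image.1 hU
    simp only [mem_filter, mem_univ, true_and] at hx hy
    obtain ⟨z, hz⟩ := hf x y hne (hx.trans hy.symm)
    exact ⟨_, mem_image_of_mem _ (mem_univ z), hz⟩
  · rw [hparts]
    have : (univ.image fun a => ({w | f w = f a} : Finset V)) ⊆
        F.image fun b => ({w | f w = b} : Finset V) := by
      intro U hU
      obtain ⟨a, -, rfl⟩ := mem_image.1 hU
      exact mem_image_of_mem (fun b => ({w | f w = b} : Finset V)) (hF a)
    exact (card_le_card this).trans card_image_le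

/-- The sum of truncated differences is `|a - b|`, so one equation covers both alternatives in
`SetResolves`. -/
theorem setResolves_of_distToSet_eq {G : SimpleGraph V} {W : Finset V} {x y : V} (hx : x ∉ W)
    (hy : y ∉ W) {a b : ℕ} (ha : distToSet G x W = a) (hb : distToSet G y W = b)
    (h : G.dist x y = (a - b) + (b - a)) : SetResolves G W x y := by
  refine ⟨hx, hy, ?_⟩
  rw [G.dist_comm (u := y), ha, hb]
  omega

namespace CycleWithLegs

variable [Fintype V] {G : SimpleGraph V} [DecidableRel G.Adj] {t : ℕ} (X : CycleWithLegs G t)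
include X

theorem card_le_of_strongResolvingPartition [DecidableEq V] {P : Finpartition (univ : Finset V)}
    (hP : IsStrongResolvingPartition G P) : (endVertices G).card + 1 ≤ P.parts.card := by
  have ht := X.four_le
  rw [← card_insert_of_notMem (a := X.c (t / 2)) fun h => X.leaf_ne_c h (by omega) rfl]
  refine hP.card_le X.conn fun x hx y hy hne => ?_
  rcases mem_insert.1 hx with rfl | hx <;> rcases mem_insert.1 hy with rfl | hy
  · exact absurd rfl hne
  · exact (X.isMutuallyMaxDistant_leaf_c hy (Or.inl rfl)).symm
  · exact X.isMutuallyMaxDistant_leaf_c hx (Or.inl rfl)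
  · exact X.isMutuallyMaxDistant_leaf_leaf hx hy hne

/-- A colouring by end-vertices and the vertex opposite to `c 0`: every path `leg u` has the colour
`u`, the first half of the cycle has the colour `u₁` and the second half the colour `u₂`. -/
theorem exists_colouring (u₁ u₂ : V) : ∃ f : V → V,
    (∀ i < t, f (X.c i) = if i < t / 2 then u₁ else if i ≤ t - t / 2 then X.c (t / 2) else u₂) ∧
      ∀ u ∈ endVertices G, ∀ a, 0 < a → a ≤ X.len u → f (X.leg u a) = u := by
  have : ∀ x, ∃ y, (∀ i < t, x = X.c i →
      y = if i < t / 2 then u₁ else if i ≤ t - t / 2 then X.c (t / 2) else u₂) ∧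
        ∀ u ∈ endVertices G, ∀ a, 0 < a → a ≤ X.len u → x = X.leg u a → y = u := by
    intro x
    rcases X.cover x with ⟨i, hi, rfl⟩ | ⟨u, hu, a, ha, hal, rfl⟩
    · refine ⟨if i < t / 2 then u₁ else if i ≤ t - t / 2 then X.c (t / 2) else u₂,
        fun j hj h => ?_, fun u hu a ha hal h => absurd h.symm (X.leg_ne_c hu ha hal hi)⟩
      rw [← X.c_inj hi hj h]
    · exact ⟨u, fun j hj h => absurd h (X.leg_ne_c hu ha hal hj),
        fun u' hu' b hb hbl h => X.leg_inj hu hu' ha hal hb hbl h⟩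
  choose f hf1 hf2 using this
  exact ⟨f, fun i hi => hf1 _ i hi rfl, fun u hu a ha hal => hf2 _ u hu a ha hal rfl⟩

theorem exists_strongResolvingPartition [DecidableEq V] (h2 : 2 ≤ (endVertices G).card) :
    ∃ P : Finpartition (univ : Finset V), IsStrongResolvingPartition G P ∧
      P.parts.card ≤ (endVertices G).card + 1 := by
  have ht := X.four_le
  -- Two colours are needed on the cycle: mirror images in its two halves are equally far from the
  -- opposite vertices, so that part cannot resolve them.
  obtain ⟨u₁, hu₁, u₂, hu₂, hne⟩ := one_lt_card.1 h2
  obtain ⟨f, hfc, hfl⟩ := X.exists_colouring u₁ u₂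
  have hmid : ∀ u ∈ endVertices G, u ≠ X.c (t / 2) := fun u hu => X.leaf_ne_c hu (by omega)
  rw [← card_insert_of_notMem (a := X.c (t / 2)) fun h => hmid _ h rfl]
  have hfmid : f (X.c (t / 2)) = X.c (t / 2) := by
    rw [hfc _ (by omega), if_neg (by omega), if_pos (by omega)]
  have hfzero : f (X.c 0) = u₁ := by rw [hfc _ (by omega), if_pos (by omega)]
  -- the position of a vertex with a given colour
  have hcol : ∀ x, (∃ i, t / 2 ≤ i ∧ i ≤ t - t / 2 ∧ x = X.c i ∧ f x = X.c (t / 2)) ∨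
      (∃ u ∈ endVertices G, ∃ a, 0 < a ∧ a ≤ X.len u ∧ x = X.leg u a ∧ f x = u) ∨
      (∃ i < t / 2, x = X.c i ∧ f x = u₁) ∨
      (∃ i, t - t / 2 < i ∧ i < t ∧ x = X.c i ∧ f x = u₂) := by
    intro x
    rcases X.cover x with ⟨i, hi, rfl⟩ | ⟨u, hu, a, ha, hal, rfl⟩
    · have := hfc i hi
      split_ifs at this with h1 h2
      · exact Or.inr (Or.inr (Or.inl ⟨i, h1, rfl, this⟩))
      · exact Or.inl ⟨i, by omega, h2, rfl, this⟩
      · exact Or.inr (Or.inr (Or.inr ⟨i, by omega, hi, rfl, this⟩))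
    · exact Or.inr (Or.inl ⟨u, hu, a, ha, hal, rfl, hfl u hu a ha hal⟩)
  set B : Finset V := {w | f w = f (X.c (t / 2))} with hB
  have hmemB : ∀ x, x ∈ B ↔ f x = X.c (t / 2) := fun x => by simp [hB, hfmid]
  have hcB : ∀ i, t / 2 ≤ i → i ≤ t - t / 2 → X.c i ∈ B := fun i h1 h2 => by
    rw [hmemB, hfc i (by omega), if_neg (by omega), if_pos h2]
  have hBc : ∀ w ∈ B, ∃ i, t / 2 ≤ i ∧ i ≤ t - t / 2 ∧ w = X.c i := by
    intro w hw
    rw [hmemB] at hw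
    rcases hcol w with ⟨i, h1, h2, h3, -⟩ | ⟨u, hu, a, -, -, -, h⟩ | ⟨i, -, -, h⟩ | ⟨i, -, -, -, h⟩
    · exact ⟨i, h1, h2, h3⟩
    · exact absurd (h.symm.trans hw) (hmid u hu)
    · exact absurd (h.symm.trans hw) (hmid _ hu₁)
    · exact absurd (h.symm.trans hw) (hmid _ hu₂)
  have hdleg : ∀ u ∈ endVertices G, ∀ a, 0 < a → a ≤ X.len u →
      distToSet G (X.leg u a) B = a + t / 2 := by
    intro u hu a ha hal
    rw [distToSet_eq (hcB (t / 2) le_rfl (by omega)), X.dist_leg_c hu ha hal (by omega)]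
    · unfold cycDist
      omega
    · intro w hw
      obtain ⟨i, h1, h2, rfl⟩ := hBc w hw
      rw [X.dist_leg_c hu ha hal (by omega), X.dist_leg_c hu ha hal (by omega)]
      unfold cycDist
      omega
  have hdleft : ∀ i < t / 2, distToSet G (X.c i) B = t / 2 - i := by
    intro i hi
    rw [distToSet_eq (hcB (t / 2) le_rfl (by omega)), X.dist_c (by omega) (by omega)]
    · unfold cycDist
      omega
    · intro w hw
      obtain ⟨j, h1, h2, rfl⟩ := hBc w hw
      rw [X.dist_c (by omega) (by omega), X.dist_c (by omega) (by omega)]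
      unfold cycDist
      omega
  have hdright : ∀ i, t - t / 2 < i → i < t → distToSet G (X.c i) B = i - (t - t / 2) := by
    intro i hi hit
    rw [distToSet_eq (hcB (t - t / 2) (by omega) le_rfl), X.dist_c (by omega) (by omega)]
    · unfold cycDist
      omega
    · intro w hw
      obtain ⟨j, h1, h2, rfl⟩ := hBc w hw
      rw [X.dist_c (by omega) (by omega), X.dist_c (by omega) (by omega)]
      unfold cycDist
      omega
  -- From a leg vertex, the geodesic to either half of the cycle passes `c 0` and continues on a
  -- geodesic to `B`.
  have hleg_c : ∀ u ∈ endVertices G, ∀ a, 0 < a → a ≤ X.len u → ∀ i < t, X.leg u a ∉ B →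
      X.c i ∉ B → f (X.leg u a) = f (X.c i) → SetResolves G B (X.leg u a) (X.c i) := by
    intro u hu a ha hal i hi h1 h2 hf
    rcases lt_or_ge i (t / 2) with hlt | hge
    · refine setResolves_of_distToSet_eq h1 h2 (hdleg u hu a ha hal) (hdleft i hlt) ?_
      rw [X.dist_leg_c hu ha hal hi]
      unfold cycDist
      omega
    · have : t - t / 2 < i := by
        by_contra hle
        exact h2 (hcB i hge (by omega))
      refine setResolves_of_distToSet_eq h1 h2 (hdleg u hu a ha hal) (hdright i this hi) ?_
      rw [X.dist_leg_c hu ha hal hi]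
      unfold cycDist
      omega
  refine StrongDim.exists_strongResolvingPartition (f := f) (fun x => ?_) fun x y hxy hf => ?_
  · rcases hcol x with ⟨i, -, -, -, h⟩ | ⟨u, hu, a, -, -, -, h⟩ | ⟨i, -, -, h⟩ | ⟨i, -, -, -, h⟩
    all_goals
      rw [h]
      simp [*]
  · by_cases hxB : x ∈ B
    · have hyB : y ∈ B := by rwa [hmemB, ← hf, ← hmemB]
      -- Inside `B` there are different vertices only for odd `t`, and then two adjacent ones. The
      -- part of colour `u₁` resolves them: `c (t / 2 - 1)` is its nearest vertex to both, at
      -- distances one and two.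
      refine ⟨X.c 0, ?_⟩
      rw [hfzero]
      set W : Finset V := {w | f w = u₁} with hW
      have hnW : ∀ w ∈ B, w ∉ W := fun w hw hw' => by
        rw [hmemB] at hw
        simp only [hW, mem_filter, mem_univ, true_and] at hw'
        exact hmid u₁ hu₁ (hw'.symm.trans hw)
      have hpred : X.c (t / 2 - 1) ∈ W := by
        simp only [hW, mem_filter, mem_univ, true_and]
        rw [hfc _ (by omega), if_pos (by omega)]
      have hdist : ∀ i, t / 2 ≤ i → i ≤ t - t / 2 →
          distToSet G (X.c i) W = i + 1 - t / 2 := by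
        intro i h1 h2
        rw [distToSet_eq hpred, X.dist_c (by omega) (by omega)]
        · unfold cycDist
          omega
        · intro w hw
          simp only [hW, mem_filter, mem_univ, true_and] at hw
          rcases hcol w with ⟨j, -, -, -, h⟩ | ⟨u, hu, a, ha, hal, rfl, h⟩ | ⟨j, hj, rfl, h⟩ |
            ⟨j, -, -, -, h⟩
          · exact absurd (hw.symm.trans h) (hmid u₁ hu₁)
          · rw [G.dist_comm (v := X.leg u a), X.dist_leg_c hu ha hal (by omega),
              X.dist_c (by omega) (by omega)]
            unfold cycDist
            omega
          · rw [X.dist_c (by omega) (by omega), X.dist_c (by omega) (by omega)]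
            unfold cycDist
            omega
          · exact absurd (hw.symm.trans h) hne
      obtain ⟨i, hi1, hi2, rfl⟩ := hBc x hxB
      obtain ⟨j, hj1, hj2, rfl⟩ := hBc y hyB
      refine setResolves_of_distToSet_eq (hnW _ hxB) (hnW _ hyB) (hdist i hi1 hi2)
        (hdist j hj1 hj2) ?_
      rw [X.dist_c (by omega) (by omega)]
      unfold cycDist
      omega
    · have hyB : y ∉ B := by rwa [hmemB, ← hf, ← hmemB]
      refine ⟨X.c (t / 2), ?_⟩
      change SetResolves G B x y
      rcases hcol x with ⟨i, h1, h2, rfl, -⟩ | ⟨u, hu, a, ha, hal, rfl, hx⟩ | ⟨i, hi, rfl, hx⟩ |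
        ⟨i, hi, hit, rfl, hx⟩
      · exact absurd (hcB i h1 h2) hxB
      all_goals
        rcases hcol y with ⟨j, h1, h2, rfl, -⟩ | ⟨u', hu', b, hb, hbl, rfl, hy⟩ | ⟨j, hj, rfl, hy⟩ |
          ⟨j, hj, hjt, rfl, hy⟩
        · exact absurd (hcB j h1 h2) hyB
      · have : u = u' := hx.symm.trans (hf.trans hy)
        subst this
        refine setResolves_of_distToSet_eq hxB hyB (hdleg u hu a ha hal) (hdleg u hu b hb hbl) ?_
        rcases le_total a b with h | h
        · rw [X.leg_dist hu h hbl]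
          omega
        · rw [G.dist_comm, X.leg_dist hu h hal]
          omega
      · exact hleg_c u hu a ha hal j (by omega) hxB hyB hf
      · exact hleg_c u hu a ha hal j hjt hxB hyB hf
      · exact (hleg_c u' hu' b hb hbl i (by omega) hyB hxB hf.symm).symm
      · refine setResolves_of_distToSet_eq hxB hyB (hdleft i hi) (hdleft j hj) ?_
        rw [X.dist_c (by omega) (by omega)]
        unfold cycDist
        omega
      · exact absurd (hx.symm.trans (hf.trans hy)) hne
      · exact (hleg_c u' hu' b hb hbl i hit hyB hxB hf.symm).symm
      · exact absurd (hx.symm.trans (hf.trans hy)) hne.symm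
      · refine setResolves_of_distToSet_eq hxB hyB (hdright i hi hit) (hdright j hj hjt) ?_
        rw [X.dist_c (by omega) (by omega)]
        unfold cycDist
        omega

theorem strongPartitionDim_eq [DecidableEq V] (h2 : 2 ≤ (endVertices G).card) :
    strongPartitionDim G = (endVertices G).card + 1 := by
  obtain ⟨P, hP, hc⟩ := X.exists_strongResolvingPartition h2
  have hle : strongPartitionDim G ≤ P.parts.card := Nat.sInf_le ⟨P, hP, rfl⟩
  refine le_antisymm (hle.trans hc) (le_csInf ⟨_, P, hP, rfl⟩ ?_)
  rintro k ⟨P', hP', rfl⟩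
  exact X.card_le_of_strongResolvingPartition hP'

end CycleWithLegs

end

/-! ### From the definition of the class to coordinates -/

section

variable {V : Type*}

/-- Deleting an edge of the cycle keeps the graph connected and destroys its only cycle, which
leaves a tree. -/
theorem IsUnicyclicWith.card_edgeFinset [Fintype V] {G : SimpleGraph V} [DecidableRel G.Adj]
    {C : G.Subgraph} (h : IsUnicyclicWith G C) : G.edgeFinset.card = Fintype.card V := by
  classical
  obtain ⟨hG, ⟨u, c, hc, rfl⟩, huniq⟩ := h
  obtain ⟨e, he⟩ : ∃ e, e ∈ c.edges := by
    refine List.exists_mem_of_ne_nil _ fun h => ?_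
    have := hc.three_le_length
    rw [← SimpleGraph.Walk.length_edges, h] at this
    simp at this
  have heG : e ∈ G.edgeSet := c.edges_subset_edgeSet he
  have hbridge : ¬ G.IsBridge e := fun hb =>
    (SimpleGraph.isBridge_iff_forall_cycle_notMem heG).1 hb c hc he
  have hconn : (G.deleteEdges {e}).Connected := by
    induction e using Sym2.ind with
    | _ a b => exact hG.connected_delete_edge_of_not_isBridge hbridge
  have htree : (G.deleteEdges {e}).IsTree := by
    refine ⟨hconn, fun w p hp => ?_⟩
    have hle : G.deleteEdges {e} ≤ G := SimpleGraph.deleteEdges_le _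
    have hC := huniq _ ⟨w, p.mapLe hle, hp.mapLe hle, rfl⟩
    have : e ∈ (p.mapLe hle).edges := by
      rw [← SimpleGraph.Walk.mem_edges_toSubgraph, hC, SimpleGraph.Walk.mem_edges_toSubgraph]
      exact he
    rw [SimpleGraph.Walk.edges_mapLe_eq_edges] at this
    have := p.edges_subset_edgeSet this
    simp at this
  have hcard := htree.card_edgeFinset
  have hdel : (G.deleteEdges {e}).edgeFinset = G.edgeFinset.erase e := by
    ext e'
    simp [and_comm]
  rw [hdel, card_erase_of_mem (by simpa using heG)] at hcard
  have := card_pos.2 ⟨e, (by simpa using heG : e ∈ G.edgeFinset)⟩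
  omega

/-- The values `deg x - 2` sum to zero. Those of `v` and the end-vertices cancel, and the others are
nonnegative, hence zero. -/
theorem degree_le_two [Fintype V] {G : SimpleGraph V} [DecidableRel G.Adj] {C : G.Subgraph}
    (h : IsUnicyclicWith G C) {v : V} (hv : 2 < G.degree v)
    (hend : G.degree v - 2 = (endVertices G).card) {w : V} (hw : w ≠ v) : G.degree w ≤ 2 := by
  classical
  have : Nontrivial V := ⟨w, v, hw⟩
  have hpos : ∀ x, 0 < G.degree x := fun x => h.1.preconnected.degree_pos_of_nontrivial x
  by_cases hwe : w ∈ endVertices G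
  · simp only [endVertices, mem_filter] at hwe
    omega
  have hve : v ∉ endVertices G := by
    simp only [endVertices, mem_filter]
    omega
  have hsum : ∑ x, ((G.degree x : ℤ) - 2) = 0 := by
    have h1 := G.sum_degrees_eq_twice_card_edges
    rw [h.card_edgeFinset] at h1
    rw [sum_sub_distrib, ← Nat.cast_sum, h1]
    simp [mul_comm]
  have hends : ∑ x ∈ endVertices G, ((G.degree x : ℤ) - 2) = -(endVertices G).card := by
    rw [sum_congr rfl (g := fun _ => (-1 : ℤ))]
    · simp
    · intro x hx
      simp only [endVertices, mem_filter] at hx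
      rw [hx.2]
      norm_num
  rw [← sum_sdiff (subset_univ (insert v (endVertices G))), sum_insert hve, hends] at hsum
  have hrest : ∑ x ∈ univ \ insert v (endVertices G), ((G.degree x : ℤ) - 2) = 0 := by omega
  have hge : ∀ x ∈ univ \ insert v (endVertices G), 0 ≤ (G.degree x : ℤ) - 2 := by
    intro x hx
    simp only [endVertices, mem_sdiff, mem_insert, mem_filter, mem_univ, true_and, not_or] at hx
    have := hpos x
    omega
  have := (sum_eq_zero_iff_of_nonneg hge).1 hrest w (by simp [hw, hwe])
  omega

theorem eq_or_eq_of_degree_le_two [Fintype V] {G : SimpleGraph V} [DecidableRel G.Adj]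
    {x a b z : V} (hx : G.degree x ≤ 2) (ha : G.Adj x a) (hb : G.Adj x b) (hab : a ≠ b)
    (hz : G.Adj x z) : z = a ∨ z = b := by
  classical
  by_contra! h
  have hsub : {z, a, b} ⊆ G.neighborFinset x := by
    intro y hy
    simp only [mem_insert, mem_singleton] at hy
    rcases hy with rfl | rfl | rfl <;> simpa
  have := card_le_card hsub
  rw [card_eq_three.2 ⟨z, a, b, h.1, h.2, hab, rfl⟩, SimpleGraph.card_neighborFinset_eq_degree]
    at this
  omega

theorem eq_of_mem_endVertices [Fintype V] {G : SimpleGraph V} [DecidableRel G.Adj]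
    {u a b : V} (hu : u ∈ endVertices G) (ha : G.Adj u a) (hb : G.Adj u b) : a = b := by
  simp only [endVertices, mem_filter] at hu
  rw [← SimpleGraph.card_neighborFinset_eq_degree] at hu
  exact card_le_one.1 hu.2.le a (by simpa) b (by simpa)

theorem dist_getVert {G : SimpleGraph V} (hG : G.Connected) {x y : V} {w : G.Walk x y}
    (hw : w.length = G.dist x y) {a b : ℕ} (hab : a ≤ b) (hb : b ≤ w.length) :
    G.dist (w.getVert a) (w.getVert b) = b - a := by
  have hle : ∀ a b, a ≤ b → b ≤ w.length → G.dist (w.getVert a) (w.getVert b) ≤ b - a := by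
    intro a b hab
    induction b, hab using Nat.le_induction with
    | base => simp
    | succ b hab ih =>
      intro hb
      have h1 : G.dist (w.getVert b) (w.getVert (b + 1)) = 1 :=
        SimpleGraph.dist_eq_one_iff_adj.2 (w.adj_getVert_succ hb)
      have := hG.dist_triangle (u := w.getVert a) (v := w.getVert b) (w := w.getVert (b + 1))
      have := ih (by omega)
      omega
  have h1 := hle 0 a (Nat.zero_le _) (hab.trans hb)
  have h2 := hle a b hab hb
  have h3 := hle b w.length hb le_rfl
  rw [w.getVert_zero] at h1
  rw [w.getVert_length] at h3
  have h4 := hG.dist_triangle (u := x) (v := w.getVert a) (w := y)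
  have h5 := hG.dist_triangle (u := w.getVert a) (v := w.getVert b) (w := y)
  omega

theorem ncard_verts_toSubgraph {G : SimpleGraph V} {u : V} {c : G.Walk u u} (hc : c.IsCycle) :
    c.toSubgraph.verts.ncard = c.length := by
  classical
  have h : c.toSubgraph.verts = (c.support.tail.toFinset : Set V) := by
    ext x
    rw [SimpleGraph.Walk.mem_verts_toSubgraph, List.coe_toFinset, Set.mem_ofPred_eq]
    constructor
    · intro hx
      rcases (SimpleGraph.Walk.mem_support_iff c).1 hx with rfl | hx
      · exact c.end_mem_tail_support hc.not_nil
      · exact hx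
    · exact List.mem_of_mem_tail
  rw [h, Set.ncard_coe_finset, List.toFinset_card_of_nodup hc.support_nodup]
  simp

/-- The cycle is rotated to start at `v`, and the legs are chosen geodesics from `v` to the
end-vertices. Degrees at most two away from `v` keep these paths from meeting or branching. -/
theorem IsFamilyC1.nonempty_cycleWithLegs [Fintype V] {G : SimpleGraph V} [DecidableRel G.Adj]
    {r t : ℕ} (h : IsFamilyC1 G r t) : Nonempty (CycleWithLegs G t) := by
  classical
  obtain ⟨hr, ht, C, hC, hCt, v, hvC, hdeg, -, -, hdv, hτ⟩ := h
  have hG := hC.1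
  have hle2 : ∀ w, w ≠ v → G.degree w ≤ 2 := fun w hw =>
    degree_le_two hC hdeg (hdv.trans hτ.symm) hw
  obtain ⟨c, hc, hct⟩ : ∃ c : G.Walk v v, c.IsCycle ∧ c.length = t := by
    obtain ⟨u, c, hc, rfl⟩ := hC.2.1
    rw [SimpleGraph.Walk.mem_verts_toSubgraph] at hvC
    refine ⟨c.rotate v hvC, hc.rotate hvC, ?_⟩
    rw [← ncard_verts_toSubgraph (hc.rotate hvC), SimpleGraph.Walk.toSubgraph_rotate, hCt]
  have c_inj : ∀ {i j}, i < t → j < t → c.getVert i = c.getVert j → i = j := fun {i j} hi hj h =>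
    hc.getVert_injOn' (by rw [Set.mem_ofPred_eq]; omega) (by rw [Set.mem_ofPred_eq]; omega) h
  have c_ne : ∀ i, 0 < i → i < t → c.getVert i ≠ v := fun i hi hit h => by
    have := c_inj hit (by omega) (h.trans c.getVert_zero.symm)
    omega
  have c_adj : ∀ {i}, i < t → G.Adj (c.getVert i) (c.getVert (i + 1)) := fun hi =>
    c.adj_getVert_succ (hct ▸ hi)
  have c_pred : ∀ {i}, 0 < i → i < t → G.Adj (c.getVert i) (c.getVert (i - 1)) := fun {i} h0 hi => by
    have := c_adj (show i - 1 < t by omega)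
    rw [Nat.sub_add_cancel h0] at this
    exact this.symm
  have c_sub_ne : ∀ {i}, i < t → c.getVert (i - 1) ≠ c.getVert (i + 1) := fun hi =>
    hc.getVert_sub_one_ne_getVert_add_one (by omega)
  have c_nbr : ∀ {i z}, 0 < i → i < t → G.Adj (c.getVert i) z →
      z = c.getVert (i - 1) ∨ z = c.getVert (i + 1) := fun h0 hi hz =>
    eq_or_eq_of_degree_le_two (hle2 _ (c_ne _ h0 hi)) (c_pred h0 hi) (c_adj hi) (c_sub_ne hi) hz
  have c_last : c.getVert t = c.getVert 0 := by
    rw [← hct, c.getVert_length, c.getVert_zero]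
  have hτv : ∀ u ∈ endVertices G, u ≠ v := by
    rintro u hu rfl
    simp only [endVertices, mem_filter] at hu
    omega
  choose p hp using fun u => hG.exists_walk_length_eq_dist v u
  have len_pos : ∀ {u}, u ∈ endVertices G → 0 < (p u).length := fun {u} hu => by
    rw [hp]
    exact hG.pos_dist_of_ne (hτv u hu).symm
  have leg_ne : ∀ u a, 0 < a → a ≤ (p u).length → (p u).getVert a ≠ v := by
    intro u a ha hal h
    have := dist_getVert hG (hp u) (Nat.zero_le a) hal
    rw [h, (p u).getVert_zero] at this
    simp at this
    omega
  have leg_adj : ∀ {u a}, a < (p u).length → G.Adj ((p u).getVert a) ((p u).getVert (a + 1)) :=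
    fun h => SimpleGraph.Walk.adj_getVert_succ _ h
  have leg_pred : ∀ {u a}, 0 < a → a ≤ (p u).length →
      G.Adj ((p u).getVert a) ((p u).getVert (a - 1)) := fun {u a} h0 ha => by
    have := leg_adj (u := u) (show a - 1 < (p u).length by omega)
    rw [Nat.sub_add_cancel h0] at this
    exact this.symm
  have leg_sub_ne : ∀ {u a}, 0 < a → a < (p u).length →
      (p u).getVert (a - 1) ≠ (p u).getVert (a + 1) := fun {u a} h0 ha h => by
    have := dist_getVert hG (hp u) (show a - 1 ≤ a + 1 by omega) ha
    rw [h] at this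
    simp at this
    omega
  have leg_nbr : ∀ {u a z}, u ∈ endVertices G → 0 < a → a ≤ (p u).length →
      G.Adj ((p u).getVert a) z →
      z = (p u).getVert (a - 1) ∨ (a < (p u).length ∧ z = (p u).getVert (a + 1)) := by
    intro u a z hu h0 ha hz
    rcases ha.lt_or_eq with hlt | rfl
    · exact (eq_or_eq_of_degree_le_two (hle2 _ (leg_ne u a h0 ha)) (leg_pred h0 ha) (leg_adj hlt)
        (leg_sub_ne h0 hlt) hz).imp id fun h => ⟨hlt, h⟩
    · refine Or.inl (eq_of_mem_endVertices ?_ hz (leg_pred h0 ha))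
      rwa [(p u).getVert_length]
  -- A set that can be left only through `v` traps the rest of a leg that enters it, so it contains
  -- the end-vertex.
  have leg_propagate : ∀ {A : Set V}, (∀ x ∈ A, ∀ z, G.Adj x z → z ∈ A ∨ z = v) → ∀ {u a},
      0 < a → a ≤ (p u).length → (p u).getVert a ∈ A → u ∈ A := by
    intro A hA u a h0 ha haA
    have : ∀ b, a ≤ b → b ≤ (p u).length → (p u).getVert b ∈ A := by
      intro b hab
      induction b, hab using Nat.le_induction with
      | base => exact fun _ => haA
      | succ b hab ih =>
        intro hb
        exact (hA _ (ih (by omega)) _ (leg_adj hb)).resolve_right (leg_ne u _ (by omega) hb)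
    simpa using this _ ha le_rfl
  have leg_ne_c : ∀ {u a i}, u ∈ endVertices G → 0 < a → a ≤ (p u).length → i < t →
      (p u).getVert a ≠ c.getVert i := by
    intro u a i hu h0 ha hi h
    have hi0 : 0 < i := by
      by_contra hi0
      rw [show i = 0 by omega, c.getVert_zero] at h
      exact leg_ne u a h0 ha h
    obtain ⟨j, hj0, hj, rfl⟩ := leg_propagate (A := {x | ∃ j, 0 < j ∧ j < t ∧ x = c.getVert j}) (by
      rintro x ⟨j, hj0, hj, rfl⟩ z hz
      by_cases hzv : z = v
      · exact Or.inr hzv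
      rcases c_nbr hj0 hj hz with rfl | rfl
      · refine Or.inl ⟨j - 1, ?_, by omega, rfl⟩
        by_contra h
        rw [show j - 1 = 0 by omega, c.getVert_zero] at hzv
        exact hzv rfl
      · refine Or.inl ⟨j + 1, by omega, ?_, rfl⟩
        by_contra h
        rw [show j + 1 = t by omega, c_last, c.getVert_zero] at hzv
        exact hzv rfl) h0 ha ⟨i, hi0, hi, h⟩
    -- The end-vertex would be a cycle vertex with two different neighbours.
    exact c_sub_ne hj (eq_of_mem_endVertices hu (c_pred hj0 hj) (c_adj hj))
  have leg_inj : ∀ {u u' a b}, u ∈ endVertices G → u' ∈ endVertices G → 0 < a →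
      a ≤ (p u).length → 0 < b → b ≤ (p u').length →
      (p u).getVert a = (p u').getVert b → u = u' := by
    intro u u' a b hu hu' ha0 ha hb0 hb h
    obtain ⟨j, hj0, hj, hju⟩ := leg_propagate
      (A := {x | ∃ j, 0 < j ∧ j ≤ (p u').length ∧ x = (p u').getVert j}) (by
        rintro x ⟨j, hj0, hj, rfl⟩ z hz
        by_cases hzv : z = v
        · exact Or.inr hzv
        rcases leg_nbr hu' hj0 hj hz with rfl | ⟨hlt, rfl⟩
        · refine Or.inl ⟨j - 1, ?_, by omega, rfl⟩
          by_contra h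
          rw [show j - 1 = 0 by omega, SimpleGraph.Walk.getVert_zero] at hzv
          exact hzv rfl
        · exact Or.inl ⟨j + 1, by omega, hlt, rfl⟩) ha0 ha ⟨b, hb0, hb, h⟩
    rcases hj.lt_or_eq with hlt | rfl
    · exact absurd (eq_of_mem_endVertices (hju ▸ hu) (leg_pred hj0 hj) (leg_adj hlt))
        (leg_sub_ne hj0 hlt)
    · rw [hju, SimpleGraph.Walk.getVert_length]
  -- The two cycle neighbours and the first vertices of the r legs are distinct, and `deg v = r + 2`
  -- leaves no room for others.
  have hnbr : G.neighborFinset v = {c.getVert 1, c.getVert (t - 1)} ∪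
      (endVertices G).image fun u => (p u).getVert 1 := by
    symm
    refine eq_of_subset_of_card_le ?_ ?_
    · intro x hx
      simp only [mem_union, mem_insert, mem_singleton, mem_image] at hx
      rw [SimpleGraph.mem_neighborFinset]
      rcases hx with (rfl | rfl) | ⟨u, hu, rfl⟩
      · simpa using c_adj (i := 0) (by omega)
      · have := c_adj (i := t - 1) (by omega)
        rw [Nat.sub_add_cancel (by omega), c_last, c.getVert_zero] at this
        exact this.symm
      · simpa using leg_adj (len_pos hu)
    · rw [card_union_of_disjoint, card_pair, card_image_of_injOn, hτ,
        SimpleGraph.card_neighborFinset_eq_degree]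
      · omega
      · intro u hu u' hu' h
        exact leg_inj hu hu' one_pos (len_pos hu) one_pos (len_pos hu') h
      · intro h
        have := c_inj (by omega) (by omega) h
        omega
      · refine disjoint_left.2 fun x hx hx' => ?_
        obtain ⟨u, hu, rfl⟩ := mem_image.1 hx'
        simp only [mem_insert, mem_singleton] at hx
        rcases hx with h | h
        · exact leg_ne_c hu one_pos (len_pos hu) (by omega) h
        · exact leg_ne_c hu one_pos (len_pos hu) (by omega) h
  have cover : ∀ x, (∃ i < t, x = c.getVert i) ∨
      ∃ u ∈ endVertices G, ∃ a, 0 < a ∧ a ≤ (p u).length ∧ x = (p u).getVert a := by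
    have hv0 : ∃ i < t, v = c.getVert i := ⟨0, by omega, by simp⟩
    -- The set of vertices with coordinates is closed under adjacency, so by connectedness it is
    -- everything.
    have hstep : ∀ x z, G.Adj x z → ((∃ i < t, x = c.getVert i) ∨
        ∃ u ∈ endVertices G, ∃ a, 0 < a ∧ a ≤ (p u).length ∧ x = (p u).getVert a) →
        (∃ i < t, z = c.getVert i) ∨
        ∃ u ∈ endVertices G, ∃ a, 0 < a ∧ a ≤ (p u).length ∧ z = (p u).getVert a := by
      rintro x z hxz (⟨i, hi, rfl⟩ | ⟨u, hu, a, ha0, ha, rfl⟩)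
      · rcases Nat.eq_zero_or_pos i with rfl | hi0
        · rw [c.getVert_zero, ← SimpleGraph.mem_neighborFinset, hnbr] at hxz
          simp only [mem_union, mem_insert, mem_singleton, mem_image] at hxz
          rcases hxz with (rfl | rfl) | ⟨u, hu, rfl⟩
          · exact Or.inl ⟨1, by omega, rfl⟩
          · exact Or.inl ⟨t - 1, by omega, rfl⟩
          · exact Or.inr ⟨u, hu, 1, one_pos, len_pos hu, rfl⟩
        · rcases c_nbr hi0 hi hxz with rfl | rfl
          · exact Or.inl ⟨i - 1, by omega, rfl⟩
          · rcases (show i + 1 ≤ t from hi).lt_or_eq with hlt | heq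
            · exact Or.inl ⟨i + 1, hlt, rfl⟩
            · exact Or.inl ⟨0, by omega, by rw [heq, c_last]⟩
      · rcases leg_nbr hu ha0 ha hxz with rfl | ⟨hlt, rfl⟩
        · rcases Nat.lt_or_ge 1 a with h1 | h1
          · exact Or.inr ⟨u, hu, a - 1, by omega, by omega, rfl⟩
          · rw [show a - 1 = 0 by omega, SimpleGraph.Walk.getVert_zero]
            exact Or.inl hv0
        · exact Or.inr ⟨u, hu, a + 1, by omega, hlt, rfl⟩
    intro x
    obtain ⟨w⟩ := hG.preconnected v x
    have : ∀ {y z : V} (_ : G.Walk y z), ((∃ i < t, y = c.getVert i) ∨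
        ∃ u ∈ endVertices G, ∃ a, 0 < a ∧ a ≤ (p u).length ∧ y = (p u).getVert a) →
        (∃ i < t, z = c.getVert i) ∨
        ∃ u ∈ endVertices G, ∃ a, 0 < a ∧ a ≤ (p u).length ∧ z = (p u).getVert a := by
      intro y z w
      induction w with
      | nil => exact id
      | cons hadj _ ih => exact fun hy => ih (hstep _ _ hadj hy)
    exact this w (Or.inl hv0)
  exact ⟨{
    c := c.getVert
    leg := fun u => (p u).getVert
    len := fun u => (p u).length
    conn := hG
    four_le := ht
    c_last := c_last
    c_inj := c_inj
    c_adj := c_adj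
    c_nbr := c_nbr
    len_pos := len_pos
    leg_zero := fun {u} _ => by simp
    leg_len := fun {u} _ => (p u).getVert_length
    leg_adj := fun _ h => leg_adj h
    leg_nbr := leg_nbr
    leg_dist := fun {u a b} _ hab hb => dist_getVert hG (hp u) hab hb
    leg_inj := leg_inj
    leg_ne_c := leg_ne_c
    cover := cover }⟩

end

/-! ### Existence: a cycle with pendant vertices -/

section

/-- The cycle `0, …, t - 1` with the pendant vertices `t, …, t + r - 1` attached at `0`. -/
def cycleWithPendants (t r : ℕ) : SimpleGraph (Fin (t + r)) :=
  SimpleGraph.fromRel fun x y =>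
    (x.val + 1 = y.val ∧ y.val < t) ∨ (x.val = 0 ∧ (y.val + 1 = t ∨ t ≤ y.val))

namespace cycleWithPendants

variable {t r : ℕ}

theorem adj_iff {x y : Fin (t + r)} : (cycleWithPendants t r).Adj x y ↔ x.val ≠ y.val ∧
    (((x.val + 1 = y.val ∧ y.val < t) ∨ (x.val = 0 ∧ (y.val + 1 = t ∨ t ≤ y.val))) ∨
      ((y.val + 1 = x.val ∧ x.val < t) ∨ (y.val = 0 ∧ (x.val + 1 = t ∨ t ≤ x.val)))) := by
  rw [cycleWithPendants, SimpleGraph.fromRel_adj, ne_eq, Fin.ext_iff]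

theorem connected (ht : 4 ≤ t) : (cycleWithPendants t r).Connected := by
  have hreach : ∀ n (hn : n < t), (cycleWithPendants t r).Reachable ⟨0, by omega⟩ ⟨n, by omega⟩ := by
    intro n
    induction n with
    | zero => exact fun _ => SimpleGraph.Reachable.refl _
    | succ n ih =>
      intro hn
      refine (ih (by omega)).trans (SimpleGraph.Adj.reachable (adj_iff.2 ?_))
      dsimp only
      omega
  have hreach' : ∀ x, (cycleWithPendants t r).Reachable ⟨0, by omega⟩ x := by
    intro x
    rcases lt_or_ge x.val t with h | h
    · exact hreach x.val h
    · refine SimpleGraph.Adj.reachable (adj_iff.2 ?_)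
      dsimp only
      omega
  have : Nonempty (Fin (t + r)) := ⟨⟨0, by omega⟩⟩
  exact ⟨fun x y => (hreach' x).symm.trans (hreach' y)⟩

theorem neighborSet_inter (ht : 4 ≤ t) {x : Fin (t + r)} (hx : x.val < t) :
    ∃ a b : Fin (t + r), a ≠ b ∧ (a.val = if x.val + 1 = t then 0 else x.val + 1) ∧
      {y | (cycleWithPendants t r).Adj x y ∧ y.val < t} = {a, b} := by
  refine ⟨⟨if x.val + 1 = t then 0 else x.val + 1, by split_ifs <;> omega⟩,
    ⟨if x.val = 0 then t - 1 else x.val - 1, by split_ifs <;> omega⟩, ?_, rfl, ?_⟩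
  · rw [ne_eq, Fin.mk.injEq]
    split_ifs <;> omega
  · ext y
    simp only [Set.mem_ofPred_eq, Set.mem_insert_iff, Set.mem_singleton_iff, adj_iff, Fin.ext_iff]
    split_ifs <;> omega

/-- A cycle uses two neighbours of each of its vertices, so it avoids the pendant vertices and uses
both remaining neighbours everywhere. It is thus closed under the cyclic successor and contains all
positions below `t`. -/
theorem toSubgraph_eq (ht : 4 ≤ t) {u : Fin (t + r)} {c : (cycleWithPendants t r).Walk u u}
    (hc : c.IsCycle) :
    c.toSubgraph = (⊤ : (cycleWithPendants t r).Subgraph).induce {x | x.val < t} := by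
  have hlt : ∀ x ∈ c.support, x.val < t := by
    intro x hx
    by_contra hge
    have h2 := hc.ncard_neighborSet_toSubgraph_eq_two hx
    have hsub : c.toSubgraph.neighborSet x ⊆ {⟨0, by omega⟩} := by
      intro y hy
      have := adj_iff.1 (c.toSubgraph.adj_sub hy)
      simp only [Set.mem_singleton_iff, Fin.ext_iff]
      omega
    have := Set.ncard_le_ncard hsub
    rw [Set.ncard_singleton] at this
    omega
  have hnbr : ∀ x ∈ c.support, c.toSubgraph.neighborSet x =
      {y | (cycleWithPendants t r).Adj x y ∧ y.val < t} := by
    intro x hx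
    obtain ⟨a, b, hab, -, hN⟩ := neighborSet_inter ht (hlt x hx)
    refine Set.eq_of_subset_of_ncard_le (fun y hy => ⟨c.toSubgraph.adj_sub hy, ?_⟩) ?_
    · exact hlt y (c.mem_verts_toSubgraph.1 (c.toSubgraph.edge_vert hy.symm))
    · rw [hN, Set.ncard_pair hab, hc.ncard_neighborSet_toSubgraph_eq_two hx]
  have hnext : ∀ x ∈ c.support, ∀ y : Fin (t + r),
      (y.val = if x.val + 1 = t then 0 else x.val + 1) → y ∈ c.support := by
    intro x hx y hy
    obtain ⟨a, b, -, ha, hN⟩ := neighborSet_inter ht (hlt x hx)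
    obtain rfl : y = a := Fin.ext (hy.trans ha.symm)
    have : y ∈ c.toSubgraph.neighborSet x := by
      rw [hnbr x hx, hN]
      exact Set.mem_insert _ _
    exact c.mem_verts_toSubgraph.1 (c.toSubgraph.edge_vert this.symm)
  have hup : ∀ x ∈ c.support, ∀ n (hn : n < t), x.val ≤ n → (⟨n, by omega⟩ : Fin (t + r)) ∈ c.support := by
    intro x hx n hn hxn
    induction n, hxn using Nat.le_induction with
    | base => exact hx
    | succ n hxn ih => exact hnext _ (ih (by omega)) _ (by rw [if_neg (by dsimp only; omega)])
  have hu := c.start_mem_support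
  have hmem : ∀ x : Fin (t + r), x.val < t → x ∈ c.support := by
    intro x hx
    have h1 := hup u hu (t - 1) (by omega) (by have := hlt u hu; omega)
    have h0 := hnext _ h1 ⟨0, by omega⟩ (by rw [if_pos (by dsimp only; omega)])
    exact hup _ h0 x.val hx (Nat.zero_le _)
  refine SimpleGraph.Subgraph.ext ?_ ?_
  · ext x
    rw [SimpleGraph.Walk.mem_verts_toSubgraph]
    exact ⟨hlt x, hmem x⟩
  · ext x y
    simp only [SimpleGraph.Subgraph.induce_adj, Set.mem_ofPred_eq, SimpleGraph.Subgraph.top_adj]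
    constructor
    · intro h
      exact ⟨hlt x (c.mem_verts_toSubgraph.1 (c.toSubgraph.edge_vert h)),
        hlt y (c.mem_verts_toSubgraph.1 (c.toSubgraph.edge_vert h.symm)), c.toSubgraph.adj_sub h⟩
    · rintro ⟨hx, hy, h⟩
      have : y ∈ c.toSubgraph.neighborSet x := by
        rw [hnbr x (hmem x hx)]
        exact ⟨h, hy⟩
      exact this

theorem exists_isCycle (ht : 4 ≤ t) :
    ∃ (u : Fin (t + r)) (c : (cycleWithPendants t r).Walk u u), c.IsCycle := by
  obtain ⟨n, rfl⟩ : ∃ n, t = n + 2 := ⟨t - 2, by omega⟩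
  have hcon : (SimpleGraph.cycleGraph (n + 2)).IsContained (cycleWithPendants (n + 2) r) := by
    refine ⟨⟨⟨Fin.castAdd r, fun {a b} hab => adj_iff.2 ?_⟩, Fin.castAdd_injective _ r⟩⟩
    rw [SimpleGraph.cycleGraph_adj'] at hab
    simp only [Fin.val_castAdd]
    have ha := a.isLt
    have hb := b.isLt
    rw [Fin.sub_def, Fin.sub_def] at hab
    dsimp only at hab
    rcases lt_trichotomy a.val b.val with h | h | h
    · rw [Nat.mod_eq_of_lt (a := n + 2 - b.val + a.val) (by omega),
        show n + 2 - a.val + b.val = b.val - a.val + (n + 2) by omega, Nat.add_mod_right,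
        Nat.mod_eq_of_lt (by omega)] at hab
      omega
    · rw [h, Nat.sub_add_cancel hb.le, Nat.mod_self] at hab
      omega
    · rw [Nat.mod_eq_of_lt (a := n + 2 - a.val + b.val) (by omega),
        show n + 2 - b.val + a.val = a.val - b.val + (n + 2) by omega, Nat.add_mod_right,
        Nat.mod_eq_of_lt (by omega)] at hab
      omega
  obtain ⟨u, c, hc, -⟩ := (SimpleGraph.cycleGraph_isContained_iff (by omega)).1 hcon
  exact ⟨u, c, hc⟩

theorem card_pendants : (univ.filter fun x : Fin (t + r) => t ≤ x.val).card = r := by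
  have : (univ.filter fun x : Fin (t + r) => t ≤ x.val) = univ.map (Fin.natAddEmb t) := by
    ext x
    simp only [mem_filter, mem_univ, true_and, mem_map, Fin.natAddEmb_apply]
    refine ⟨fun h => ⟨⟨x.val - t, by omega⟩, Fin.ext (by simp; omega)⟩, ?_⟩
    rintro ⟨y, rfl⟩
    simp
  rw [this, card_map, card_univ, Fintype.card_fin]

variable [DecidableRel (cycleWithPendants t r).Adj]

theorem degree_zero (ht : 4 ≤ t) : (cycleWithPendants t r).degree ⟨0, by omega⟩ = r + 2 := by
  have : (cycleWithPendants t r).neighborFinset ⟨0, by omega⟩ =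
      insert ⟨1, by omega⟩ (insert ⟨t - 1, by omega⟩
        (univ.filter fun x : Fin (t + r) => t ≤ x.val)) := by
    ext x
    simp only [SimpleGraph.mem_neighborFinset, adj_iff, mem_insert, mem_filter, mem_univ, true_and,
      Fin.ext_iff]
    omega
  rw [← SimpleGraph.card_neighborFinset_eq_degree, this, card_insert_of_notMem,
    card_insert_of_notMem, card_pendants]
  · simp only [mem_filter, mem_univ, true_and]
    omega
  · simp only [mem_insert, mem_filter, mem_univ, true_and, Fin.ext_iff]
    omega

theorem degree_of_lt (ht : 4 ≤ t) {x : Fin (t + r)} (h0 : 0 < x.val) (hx : x.val < t) :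
    (cycleWithPendants t r).degree x = 2 := by
  obtain ⟨a, b, hab, -, hN⟩ := neighborSet_inter ht hx
  rw [← SimpleGraph.card_neighborFinset_eq_degree, ← Set.ncard_coe_finset,
    SimpleGraph.coe_neighborFinset, ← Set.ncard_pair hab, ← hN]
  congr 1
  ext y
  simp only [SimpleGraph.mem_neighborSet, Set.mem_ofPred_eq, adj_iff]
  omega

theorem degree_of_le (ht : 4 ≤ t) {x : Fin (t + r)} (hx : t ≤ x.val) :
    (cycleWithPendants t r).degree x = 1 := by
  rw [← SimpleGraph.card_neighborFinset_eq_degree, card_eq_one]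
  refine ⟨⟨0, by omega⟩, ?_⟩
  ext y
  simp only [SimpleGraph.mem_neighborFinset, adj_iff, mem_singleton, Fin.ext_iff]
  omega

theorem endVertices_eq (ht : 4 ≤ t) : endVertices (cycleWithPendants t r) =
    univ.filter fun x : Fin (t + r) => t ≤ x.val := by
  ext x
  simp only [endVertices, mem_filter, mem_univ, true_and]
  refine ⟨fun h => ?_, degree_of_le ht⟩
  by_contra hx
  rcases Nat.eq_zero_or_pos x.val with h0 | h0
  · rw [show x = ⟨0, by omega⟩ from Fin.ext h0, degree_zero ht] at h
    omega
  · rw [degree_of_lt ht h0 (by omega)] at h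
    omega

theorem isFamilyC1 (ht : 4 ≤ t) (hr : 2 ≤ r) : IsFamilyC1 (cycleWithPendants t r) r t := by
  have hconn := connected (r := r) ht
  refine ⟨hr, ht, (⊤ : (cycleWithPendants t r).Subgraph).induce {x | x.val < t},
    ⟨hconn, ?_, ?_⟩, ?_, ⟨0, by omega⟩, ?_, ?_, ?_, ?_, ?_, ?_⟩
  · obtain ⟨u, c, hc⟩ := exists_isCycle (r := r) ht
    exact ⟨u, c, hc, toSubgraph_eq ht hc⟩
  · rintro C' ⟨u, c, hc, rfl⟩
    exact toSubgraph_eq ht hc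
  · have : {x : Fin (t + r) | x.val < t} = Set.range (Fin.castAdd r) := by
      ext x
      exact ⟨fun h => ⟨⟨x.val, h⟩, rfl⟩, by rintro ⟨y, rfl⟩; simp⟩
    rw [SimpleGraph.Subgraph.induce_verts, this,
      Set.ncard_range_of_injective (Fin.castAdd_injective _ r), Nat.card_fin]
  · simp only [SimpleGraph.Subgraph.induce_verts, Set.mem_ofPred_eq]
    omega
  · rw [degree_zero ht]
    omega
  · intro w hw hdeg
    rcases Nat.eq_zero_or_pos w.val with h0 | h0
    · exact Fin.ext h0
    · rw [degree_of_lt ht h0 hw] at hdeg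
      omega
  · have : {u | IsTerminalVertex (cycleWithPendants t r)
        ((⊤ : (cycleWithPendants t r).Subgraph).induce {x | x.val < t}) ⟨0, by omega⟩ u} =
        (univ.filter fun x : Fin (t + r) => t ≤ x.val : Finset (Fin (t + r))) := by
      rw [← endVertices_eq ht]
      ext u
      refine ⟨fun h => h.1, fun hu => ⟨hu, fun w hw hw0 => ?_⟩⟩
      rw [mem_coe, endVertices_eq ht] at hu
      simp only [mem_filter, mem_univ, true_and] at hu
      simp only [SimpleGraph.Subgraph.induce_verts, Set.mem_ofPred_eq] at hw
      -- A pendant vertex is adjacent to `0` and to nothing else, so every other cycle vertex is at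
      -- distance more than one.
      rw [SimpleGraph.dist_eq_one_iff_adj.2 (adj_iff.2 (by dsimp only; omega))]
      refine hconn.one_lt_dist_of_ne_of_not_adj (fun h => ?_) fun h => ?_
      · rw [h] at hu
        omega
      · rw [adj_iff] at h
        exact hw0 (Fin.ext (by dsimp only; omega))
    rw [terminalDegree, this, Set.ncard_coe_finset, card_pendants]
  · rw [degree_zero ht]
    omega
  · rw [endVertices_eq ht, card_pendants]

end cycleWithPendants

end

end StrongDim

theorem mainTheorem4 :
    (∀ {V : Type*} [Fintype V] [DecidableEq V] (G : SimpleGraph V) [DecidableRel G.Adj]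
      (r t : ℕ), StrongDim.IsFamilyC1 G r t →
        StrongDim.strongPartitionDim G = r + 1 ∧
        (Odd t → StrongDim.strongMetricDim G = r + (t - 1) / 2) ∧
        (Even t → StrongDim.strongMetricDim G = r + (t - 2) / 2)) ∧
    (∀ r N : ℕ, 2 ≤ r →
      ∃ (t n : ℕ) (G : SimpleGraph (Fin n)) (_ : DecidableRel G.Adj),
        StrongDim.IsFamilyC1 G r t ∧
        StrongDim.strongMetricDim G = StrongDim.strongPartitionDim G + N) := by
  refine ⟨fun {V} _ _ G _ r t h => ?_, fun r N hr => ?_⟩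
  · obtain ⟨X⟩ := h.nonempty_cycleWithLegs
    obtain ⟨hr, -, -, -, -, -, -, -, -, -, -, hτ⟩ := h
    have hpd := X.strongPartitionDim_eq (by omega)
    have hdim := X.strongMetricDim_eq (card_pos.1 (by omega))
    rw [hτ] at hpd hdim
    refine ⟨hpd, fun _ => hdim, fun ht => ?_⟩
    -- For even `t` the floors `(t - 1) / 2` and `(t - 2) / 2` agree.
    obtain ⟨k, rfl⟩ := ht
    rw [hdim]
    omega
  · classical
    -- The difference of the dimensions is `(t - 1) / 2 - 1`, which is `N` for `t = 2 * N + 4`.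
    have h := StrongDim.cycleWithPendants.isFamilyC1 (t := 2 * N + 4) (r := r) (by omega) hr
    refine ⟨2 * N + 4, _, StrongDim.cycleWithPendants (2 * N + 4) r, inferInstance, h, ?_⟩
    obtain ⟨X⟩ := h.nonempty_cycleWithLegs
    obtain ⟨-, -, -, -, -, -, -, -, -, -, -, hτ⟩ := h
    rw [X.strongPartitionDim_eq (by omega), X.strongMetricDim_eq (card_pos.1 (by omega)), hτ]
    omega
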